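/- Call a finite simple undirected graph cubic if every vertex has exactly three neighbours, and symmetric if its automorphism group has a single orbit on the set of ordered pairs of adjacent vertices. There are infinitely many positive even integers $k$ such that, up to isomorphism, there are only finitely many connected symmetric cubic graphs whose order (number of vertices) is of the form $kp$ with $p$ prime (where $p$ ranges over all primes). In particular, this holds for every $k = 2\ell$ where $\ell$ is a prime congruent to $5$ modulo $6$. -/

import Mathlib

universe u

namespace CubicSymmetric

/-- A graph is symmetric (arc-transitive) if its automorphism group has a single orbit on arcs,
that is, on ordered pairs of adjacent vertices. -/
def IsSymmetric {V : Type u} (Γ : SimpleGraph V) : Prop :=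
  ∀ u v u' v' : V, Γ.Adj u v → Γ.Adj u' v' → ∃ φ : Γ ≃g Γ, φ u = u' ∧ φ v = v'

/-- A graph is cubic (3-valent) if every vertex has exactly three neighbours. -/
def IsCubic {V : Type u} (Γ : SimpleGraph V) : Prop :=
  ∀ v : V, (Γ.neighborSet v).ncard = 3

/-- `Γ` is a finite connected symmetric cubic graph whose order is `k * p` for some prime `p`. -/
structure IsCSCOfOrderMulPrime (k : ℕ) {V : Type u} (Γ : SimpleGraph V) : Prop where
  finite : Finite V
  connected : Γ.Connected
  cubic : IsCubic Γ
  symmetric : IsSymmetric Γ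
  order : ∃ p : ℕ, p.Prime ∧ Nat.card V = k * p

/-- Up to isomorphism there are only finitely many connected symmetric cubic graphs of order `k * p`
with `p` prime (`p` is not fixed): there is a finite collection of finite graphs
such that every such graph, on whatever vertex type, is isomorphic to a member of it. -/
def FinitelyManyOfOrderMulPrime (k : ℕ) : Prop :=
  ∃ S : Set (Σ n : ℕ, SimpleGraph (Fin n)), S.Finite ∧
    ∀ (V : Type u) (Γ : SimpleGraph V), IsCSCOfOrderMulPrime k Γ →
      ∃ Δ ∈ S, Nonempty (Γ ≃g Δ.2)

end CubicSymmetric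

/-! Let `G` be the full automorphism group and `Γ` a graph of order `2lp` with `l ≡ 5 (mod 6)`. It
suffices to bound `p`, since only finitely many graphs have bounded order; Dirichlet's theorem then
supplies infinitely many `l`.

Tutte's argument, in a weak form (`length_le`), makes `G` regular on `s`-arcs with `s ≤ 7`, so
`|G_v| ≤ 3 ^ 7` (`exists_card_stabilizer_le`). If `p > 2l * 3 ^ 7`, then `|G| = pm` with `m < p`,
and Sylow gives a normal subgroup `P` of order `p`.

By transfer, the centralizer `C` of `P` has a normal `p`-complement `K`, which is normal in `G`.
Nontrivial elements of `P` fix no `K`-orbit, so `K` has more than two orbits and is therefore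
semiregular. As `p` does not divide `|G_v|`, `C ∩ G_v` lies in `K` and is trivial, so `G_v` embeds
in `Aut P` and is abelian. Being also transitive on the neighbours of `v`, it has trivial arc
stabilizers (`eq_one_of_fixes_arc`).

Hence `|G_v| = 3`, and `G` is generated by `G_v` and an involution reversing an edge. The quotient
`G / P` has order `6l` and is generated by elements of order dividing `3` and `2`. No such group
exists (`closure_pair_ne_top`): because `l ≢ 1 (mod 3)`, its Sylow 3-subgroup is normal, and the
quotient by it would be cyclic of order at most `2` instead of `2l`. -/

namespace CubicSymmetric

/-! ### Transitivity and regularity on arcs of a cubic graph -/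

section Arcs

variable {V : Type*} {G : Type*} [Group G] [MulAction G V] {Γ : SimpleGraph V}

/-- Around a vertex of a cubic graph, two distinct neighbours determine the third one. -/
theorem IsCubic.exists_third (hΓ : IsCubic Γ) {v a b : V} (ha : Γ.Adj v a) (hb : Γ.Adj v b)
    (hab : a ≠ b) :
    ∃ c, Γ.Adj v c ∧ c ≠ a ∧ c ≠ b ∧ ∀ w, Γ.Adj v w → w = a ∨ w = b ∨ w = c := by
  obtain ⟨x, y, z, hxy, hxz, hyz, h⟩ := Set.ncard_eq_three.mp (hΓ v)
  have key : ∀ w, Γ.Adj v w ↔ w = x ∨ w = y ∨ w = z := fun w ↦ by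
    rw [← SimpleGraph.mem_neighborSet, h]; simp
  rcases (key a).1 ha with rfl | rfl | rfl <;> rcases (key b).1 hb with rfl | rfl | rfl <;>
  first
    | exact absurd rfl hab
    | exact ⟨x, (key x).2 (by tauto), by tauto, by tauto, fun w hw ↦ by have := (key w).1 hw; tauto⟩
    | exact ⟨y, (key y).2 (by tauto), by tauto, by tauto, fun w hw ↦ by have := (key w).1 hw; tauto⟩
    | exact ⟨z, (key z).2 (by tauto), by tauto, by tauto, fun w hw ↦ by have := (key w).1 hw; tauto⟩

theorem IsCubic.exists_adj_ne (hΓ : IsCubic Γ) (v a : V) : ∃ w, Γ.Adj v w ∧ w ≠ a := by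
  obtain ⟨x, y, z, hxy, hxz, hyz, h⟩ := Set.ncard_eq_three.mp (hΓ v)
  have key : ∀ w, Γ.Adj v w ↔ w = x ∨ w = y ∨ w = z := fun w ↦ by
    rw [← SimpleGraph.mem_neighborSet, h]; simp
  by_cases hx : x = a
  · exact ⟨y, (key y).2 (by tauto), fun h ↦ hxy (hx.trans h.symm)⟩
  · exact ⟨x, (key x).2 (by tauto), hx⟩

/-- A predicate on vertices stable under adjacency holds everywhere on a connected graph. -/
theorem forall_of_connected (hc : Γ.Connected) {Q : V → Prop} {v : V} (hv : Q v)
    (h : ∀ u w, Γ.Adj u w → Q u → Q w) (w : V) : Q w := by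
  obtain ⟨p⟩ := hc.preconnected v w
  induction p with
  | nil => exact hv
  | cons e _ ih => exact ih (h _ _ e hv)

/-- `α 0, …, α s` is an `s`-arc: a walk of length `s` without backtracking. -/
def IsArc (Γ : SimpleGraph V) (s : ℕ) (α : ℕ → V) : Prop :=
  (∀ i < s, Γ.Adj (α i) (α (i + 1))) ∧ ∀ i, i + 2 ≤ s → α i ≠ α (i + 2)

/-- `G` acts on `V` by automorphisms of `Γ`. -/
def PreservesAdj (G : Type*) [Group G] [MulAction G V] (Γ : SimpleGraph V) : Prop :=
  ∀ (g : G) (u v : V), Γ.Adj u v → Γ.Adj (g • u) (g • v)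

/-- `G` is transitive on the `s`-arcs of `Γ`. -/
def ArcTransitive (G : Type*) [Group G] [MulAction G V] (Γ : SimpleGraph V) (s : ℕ) : Prop :=
  ∀ α β : ℕ → V, IsArc Γ s α → IsArc Γ s β → ∃ g : G, ∀ i ≤ s, g • α i = β i

theorem IsArc.mono {s t : ℕ} {α : ℕ → V} (h : IsArc Γ t α) (hst : s ≤ t) : IsArc Γ s α :=
  ⟨fun i hi ↦ h.1 i (by omega), fun i hi ↦ h.2 i (by omega)⟩

theorem IsArc.tail {s : ℕ} {α : ℕ → V} (h : IsArc Γ (s + 1) α) : IsArc Γ s (fun i ↦ α (i + 1)) :=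
  ⟨fun i hi ↦ h.1 (i + 1) (by omega), fun i hi ↦ h.2 (i + 1) (by omega)⟩

theorem IsArc.reverse {s : ℕ} {α : ℕ → V} (h : IsArc Γ s α) : IsArc Γ s (fun i ↦ α (s - i)) := by
  refine ⟨fun i hi ↦ ?_, fun i hi ↦ ?_⟩
  · have := h.1 (s - (i + 1)) (by omega)
    rw [show s - (i + 1) + 1 = s - i by omega] at this
    exact this.symm
  · have := h.2 (s - (i + 2)) (by omega)
    rw [show s - (i + 2) + 2 = s - i by omega] at this
    exact this.symm

theorem IsArc.snoc {s : ℕ} {α : ℕ → V} (h : IsArc Γ (s + 1) α) {w : V}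
    (hw : Γ.Adj (α (s + 1)) w) (hne : w ≠ α s) : IsArc Γ (s + 2) (Function.update α (s + 2) w) := by
  refine ⟨fun i hi ↦ ?_, fun i hi ↦ ?_⟩
  · rw [Function.update_of_ne (by omega)]
    rcases eq_or_ne i (s + 1) with rfl | hi'
    · simpa using hw
    · rw [Function.update_of_ne (by omega)]
      exact h.1 i (by omega)
  · rw [Function.update_of_ne (by omega)]
    rcases eq_or_ne i s with rfl | hi'
    · simpa using hne.symm
    · rw [Function.update_of_ne (by omega)]
      exact h.2 i (by omega)

theorem IsCubic.exists_isArc [Nonempty V] (hΓ : IsCubic Γ) (s : ℕ) : ∃ α, IsArc Γ (s + 1) α := by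
  induction s with
  | zero =>
    obtain ⟨v⟩ := ‹Nonempty V›
    obtain ⟨w, hw, -⟩ := hΓ.exists_adj_ne v v
    refine ⟨fun i ↦ if i = 0 then v else w, fun i hi ↦ ?_, fun i hi ↦ by omega⟩
    obtain rfl : i = 0 := by omega
    simpa using hw
  | succ s ih =>
    obtain ⟨α, hα⟩ := ih
    obtain ⟨w, hw, hne⟩ := hΓ.exists_adj_ne (α (s + 1)) (α s)
    exact ⟨_, hα.snoc hw hne⟩

/-- Changing the last vertex of an arc. -/
theorem IsArc.exists_other (hΓ : IsCubic Γ) {s : ℕ} {α : ℕ → V} (h : IsArc Γ (s + 2) α) :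
    ∃ w, w ≠ α (s + 2) ∧ IsArc Γ (s + 2) (Function.update α (s + 2) w) := by
  obtain ⟨w, hw, h1, h2, -⟩ := hΓ.exists_third (h.1 s (by omega)).symm (h.1 (s + 1) (by omega))
    (h.2 s (by omega))
  exact ⟨w, h2, (h.mono (Nat.le_succ _)).snoc hw h1⟩

/-- A long arc in a finite graph revisits a vertex. Cut at the repetition, it has coinciding
vertices that become distinct once its last vertex is changed, so no group element maps one arc to
the other. -/
theorem exists_not_arcTransitive [Finite V] [Nonempty V] (hΓ : IsCubic Γ) :
    ∃ s, ¬ ArcTransitive G Γ (s + 2) := by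
  obtain ⟨α, hα⟩ := hΓ.exists_isArc (Nat.card V + 1)
  obtain ⟨i, j, hij, hj, e⟩ : ∃ i j, i < j ∧ j ≤ Nat.card V ∧ α i = α j := by
    by_contra! hcon
    have hinj : Function.Injective (fun k : Fin (Nat.card V + 1) ↦ α k) := by
      intro a b hab
      rcases lt_trichotomy a b with h | h | h
      · exact absurd hab (hcon a b h (by omega))
      · exact h
      · exact absurd hab.symm (hcon b a h (by omega))
    have := Nat.card_le_card_of_injective _ hinj
    simp at this
  obtain ⟨s, rfl⟩ : ∃ s, j = s + 2 := by
    refine ⟨j - 2, ?_⟩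
    rcases Nat.lt_or_ge j 2 with h | h
    · obtain rfl : i = 0 := by omega
      obtain rfl : j = 1 := by omega
      exact absurd e (hα.1 0 (by omega)).ne
    · omega
  refine ⟨s, fun hT ↦ ?_⟩
  have hα' := hα.mono (show s + 2 ≤ _ by omega)
  obtain ⟨w, hw, hβ⟩ := hα'.exists_other hΓ
  obtain ⟨g, hg⟩ := hT _ _ hα' hβ
  have h1 := hg i hij.le
  have h2 := hg (s + 2) le_rfl
  rw [Function.update_of_ne hij.ne, e, h2, Function.update_self] at h1
  exact hw h1

theorem exists_maximal_arcTransitive [Finite V] [Nonempty V] (hΓ : IsCubic Γ)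
    (h1 : ArcTransitive G Γ 1) :
    ∃ s, ArcTransitive G Γ (s + 1) ∧ ¬ ArcTransitive G Γ (s + 2) := by
  by_contra! hcon
  have : ∀ s, ArcTransitive G Γ (s + 1) := fun s ↦ by
    induction s with
    | zero => exact h1
    | succ s ih => exact hcon s ih
  obtain ⟨s, hs⟩ := exists_not_arcTransitive (G := G) hΓ
  exact hs (this _)

/-- An element fixing the `(s + 1)`-arc but moving the last vertex would interchange the two
possible extensions, which upgrades transitivity to `(s + 2)`-arcs. -/
theorem fixes_of_maximal (hΓ : IsCubic Γ) (hG : PreservesAdj G Γ) {s : ℕ}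
    (hT : ArcTransitive G Γ (s + 1)) (hn : ¬ ArcTransitive G Γ (s + 2)) {α : ℕ → V}
    (hα : IsArc Γ (s + 2) α) {φ : G} (hφ : ∀ i ≤ s + 1, φ • α i = α i) :
    φ • α (s + 2) = α (s + 2) := by
  by_contra hne
  have hadj := hα.1 (s + 1) (by omega)
  have hback : α s ≠ α (s + 2) := hα.2 s (by omega)
  have hφadj : Γ.Adj (α (s + 1)) (φ • α (s + 2)) := by
    simpa [hφ] using hG φ _ _ hadj
  have hφback : φ • α (s + 2) ≠ α s := fun e ↦ hback <| by
    apply smul_left_cancel φ; rw [e, hφ s (by omega)]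
  have key : ∀ β, IsArc Γ (s + 2) β → ∃ g : G, ∀ i ≤ s + 2, g • α i = β i := by
    intro β hβ
    obtain ⟨g, hg⟩ := hT α β (hα.mono (by omega)) (hβ.mono (by omega))
    have hb : Γ.Adj (α (s + 1)) (g⁻¹ • β (s + 2)) := by
      have := hG g⁻¹ _ _ (hβ.1 (s + 1) (by omega))
      rwa [← hg (s + 1) le_rfl, inv_smul_smul] at this
    have hb' : g⁻¹ • β (s + 2) ≠ α s := fun e ↦ hβ.2 s (by omega) <| by
      rw [← hg s (by omega), ← e, smul_inv_smul]
    obtain ⟨c, -, -, -, hc⟩ := hΓ.exists_third (hα.1 s (by omega)).symm hadj hback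
    have : g⁻¹ • β (s + 2) = α (s + 2) ∨ g⁻¹ • β (s + 2) = φ • α (s + 2) := by
      have := hc _ hb
      have := hc _ hφadj
      grind
    rcases this with h | h
    · refine ⟨g, fun i hi ↦ ?_⟩
      rcases Nat.lt_or_ge i (s + 2) with hi' | hi'
      · exact hg i (by omega)
      · obtain rfl : i = s + 2 := by omega
        rw [← h, smul_inv_smul]
    · refine ⟨g * φ, fun i hi ↦ ?_⟩
      rw [mul_smul]
      rcases Nat.lt_or_ge i (s + 2) with hi' | hi'
      · rw [hφ i (by omega)]
        exact hg i (by omega)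
      · obtain rfl : i = s + 2 := by omega
        rw [← h, smul_inv_smul]
  refine hn fun β γ hβ hγ ↦ ?_
  obtain ⟨g, hg⟩ := key β hβ
  obtain ⟨g', hg'⟩ := key γ hγ
  refine ⟨g' * g⁻¹, fun i hi ↦ ?_⟩
  rw [mul_smul, ← hg i hi, inv_smul_smul, hg' i hi]

/-- A group which is transitive on `s`-arcs but not on `(s + 1)`-arcs is regular on `s`-arcs. -/
theorem eq_one_of_maximal [FaithfulSMul G V] (hc : Γ.Connected) (hΓ : IsCubic Γ)
    (hG : PreservesAdj G Γ) {s : ℕ}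
    (hT : ArcTransitive G Γ (s + 1)) (hn : ¬ ArcTransitive G Γ (s + 2)) {α : ℕ → V}
    (hα : IsArc Γ (s + 1) α) {φ : G} (hφ : ∀ i ≤ s + 1, φ • α i = α i) : φ = 1 := by
  have ext : ∀ β, IsArc Γ (s + 1) β → (∀ i ≤ s + 1, φ • β i = β i) →
      ∀ w, Γ.Adj (β (s + 1)) w → w ≠ β s → ∃ γ, IsArc Γ (s + 2) γ ∧ γ (s + 2) = w ∧
        (∀ i ≤ s + 1, γ i = β i) ∧ ∀ i ≤ s + 2, φ • γ i = γ i := by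
    intro β hβ hfix w hw hne
    have hγ := hβ.snoc hw hne
    have hβγ : ∀ i ≤ s + 1, Function.update β (s + 2) w i = β i := fun i hi ↦
      Function.update_of_ne (by omega) _ _
    refine ⟨_, hγ, Function.update_self .., hβγ, fun i hi ↦ ?_⟩
    rcases Nat.lt_or_ge i (s + 2) with hi' | hi'
    · rw [hβγ i (by omega)]
      exact hfix i (by omega)
    · obtain rfl : i = s + 2 := by omega
      exact fixes_of_maximal hΓ hG hT hn hγ fun i hi ↦ by rw [hβγ i hi]; exact hfix i hi
  -- A pointwise fixed arc can be moved so as to start at any neighbour of its start: slide it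
  -- forward, or extend its reversal.
  have all : ∀ u, ∃ β, IsArc Γ (s + 1) β ∧ β 0 = u ∧ ∀ i ≤ s + 1, φ • β i = β i := by
    refine forall_of_connected hc (v := α 0) ⟨α, hα, rfl, hφ⟩ ?_
    rintro u w huw ⟨β, hβ, rfl, hfix⟩
    by_cases hw : w = β 1
    · subst hw
      obtain ⟨x, hx, hne⟩ := hΓ.exists_adj_ne (β (s + 1)) (β s)
      obtain ⟨γ, hγ, -, hβγ, hγfix⟩ := ext β hβ hfix x hx hne
      exact ⟨_, hγ.tail, hβγ 1 (by omega), fun i hi ↦ hγfix (i + 1) (by omega)⟩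
    · obtain ⟨γ, hγ, hγw, -, hγfix⟩ := ext _ hβ.reverse (fun i hi ↦ hfix _ (by omega)) w
        (by simpa using huw) (by simpa using hw)
      exact ⟨_, hγ.reverse.mono (Nat.le_succ _), hγw, fun i hi ↦ hγfix _ (by omega)⟩
  refine FaithfulSMul.eq_of_smul_eq_smul (α := V) fun u ↦ ?_
  obtain ⟨β, -, rfl, h⟩ := all u
  rw [one_smul, h 0 (by omega)]

end Arcs

/-! ### Tutte's bound on the length of regular arcs -/

section Tutte

variable {V : Type*} {G : Type*} [Group G] [MulAction G V] {Γ : SimpleGraph V}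

/-- In a cubic graph, two automorphisms fixing a vertex and one of its neighbours `b`,
and moving another neighbour `d`, agree at `d`. -/
theorem smul_eq_smul_of_moved (hΓ : IsCubic Γ) (hG : PreservesAdj G Γ) {v b d : V}
    (hb : Γ.Adj v b) (hd : Γ.Adj v d) (hbd : b ≠ d) {φ ψ : G} (hφ : φ • v = v) (hψ : ψ • v = v)
    (hφb : φ • b = b) (hψb : ψ • b = b) (hφd : φ • d ≠ d) (hψd : ψ • d ≠ d) :
    φ • d = ψ • d := by
  obtain ⟨c, -, -, -, hc⟩ := hΓ.exists_third hb hd hbd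
  have aux : ∀ χ : G, χ • v = v → χ • b = b → χ • d ≠ d → χ • d = c := by
    intro χ h1 h2 h3
    have h4 := hG χ _ _ hd
    rw [h1] at h4
    rcases hc _ h4 with h | h | h
    · exact absurd (smul_left_cancel χ (h2.trans h.symm)) hbd
    · exact absurd h h3
    · exact h
  rw [aux φ hφ hφb hφd, aux ψ hψ hψb hψd]

/-- If `c` commutes with `b` and with `[a, b]`, where `a` is an involution, then `b` commutes with
`[a, c]`. -/
theorem commute_commutator {a b c : G} (ha : a * a = 1) (h1 : Commute c b)
    (h2 : Commute c (a * b * a⁻¹ * b⁻¹)) : Commute b (a * c * a⁻¹ * c⁻¹) := by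
  have h3 : Commute c (a * b * a⁻¹) := by simpa using h2.mul_right h1
  have ha' : a⁻¹ = a := inv_eq_of_mul_eq_one_left ha
  rw [ha'] at h3 ⊢
  have h4 : Commute (a * c * a) b := by
    have h5 := congrArg (fun t ↦ a * t * a) h3.eq
    have e1 : a * (c * (a * b * a)) * a = a * c * a * b * (a * a) := by group
    have e2 : a * (a * b * a * c) * a = (a * a) * b * (a * c * a) := by group
    simp only [e1, e2, ha, mul_one, one_mul] at h5
    exact h5
  exact h4.symm.mul_right h1.symm.inv_right

/-- A bi-infinite nonbacktracking walk `a` in a graph on which `G` acts regularly on `s`-arcs,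
together with nontrivial elements `x i` fixing `a i, …, a (i + s - 1)`, all conjugate under a
shift of the walk. -/
structure ShiftedArc (G : Type*) [Group G] [MulAction G V] (Γ : SimpleGraph V) (s : ℤ) where
  a : ℤ → V
  x : ℤ → G
  adj : ∀ i, Γ.Adj (a i) (a (i + 1))
  ne : ∀ i, a i ≠ a (i + 2)
  regular : ∀ i (h : G), (∀ k, i ≤ k → k ≤ i + s → h • a k = a k) → h = 1
  x_fix : ∀ i k, i ≤ k → k < i + s → x i • a k = a k
  x_ne : ∀ i, x i ≠ 1
  commute_shift : ∀ i j m, Commute (x i) (x j) → Commute (x (i + m)) (x (j + m))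

namespace ShiftedArc

variable {s : ℤ} (F : ShiftedArc G Γ s)

theorem adj_left (i : ℤ) : Γ.Adj (F.a i) (F.a (i - 1)) := by
  have := (F.adj (i - 1)).symm
  rwa [sub_add_cancel] at this

theorem left_ne_right (i : ℤ) : F.a (i - 1) ≠ F.a (i + 1) := by
  have := F.ne (i - 1)
  rwa [show i - 1 + 2 = i + 1 by ring] at this

/-- The elements fixing `a i, …, a j`. -/
def fix (i j : ℤ) : Subgroup G where
  carrier := {h | ∀ k, i ≤ k → k ≤ j → h • F.a k = F.a k}
  one_mem' k _ _ := one_smul ..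
  mul_mem' hx hy k h1 h2 := by rw [mul_smul, hy k h1 h2, hx k h1 h2]
  inv_mem' hx k h1 h2 := by rw [inv_smul_eq_iff, hx k h1 h2]

theorem x_mem_fix {i j k : ℤ} (hi : k ≤ i) (hj : j < k + s) : F.x k ∈ F.fix i j :=
  fun m h1 h2 ↦ F.x_fix k m (hi.trans h1) (h2.trans_lt hj)

theorem eq_one_of_mem_fix {i j : ℤ} (hij : i + s ≤ j) {h : G} (hh : h ∈ F.fix i j) : h = 1 :=
  F.regular i h fun k h1 h2 ↦ hh k h1 (h2.trans hij)

theorem mem_fix_succ {i j : ℤ} {h : G} (hh : h ∈ F.fix i j) (h' : h • F.a (j + 1) = F.a (j + 1)) :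
    h ∈ F.fix i (j + 1) := fun k h1 h2 ↦ by
  rcases h2.lt_or_eq with h3 | rfl
  · exact hh k h1 (by omega)
  · exact h'

theorem mem_fix_pred {i j : ℤ} {h : G} (hh : h ∈ F.fix i j) (h' : h • F.a (i - 1) = F.a (i - 1)) :
    h ∈ F.fix (i - 1) j := fun k h1 h2 ↦ by
  rcases h1.lt_or_eq with h3 | rfl
  · exact hh k (by omega) h2
  · exact h'

theorem x_move_right (i : ℤ) : F.x i • F.a (i + s) ≠ F.a (i + s) := fun h ↦
  F.x_ne i <| F.regular i _ fun k h1 h2 ↦ by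
    rcases h2.lt_or_eq with h3 | rfl
    · exact F.x_fix i k h1 h3
    · exact h

theorem x_move_left (i : ℤ) : F.x i • F.a (i - 1) ≠ F.a (i - 1) := fun h ↦
  F.x_ne i <| F.regular (i - 1) _ fun k h1 h2 ↦ by
    rcases h1.lt_or_eq with h3 | rfl
    · exact F.x_fix i k (by omega) (by omega)
    · exact h

variable (hΓ : IsCubic Γ) (hG : PreservesAdj G Γ)
include hΓ hG

/-- Both `x i` and its inverse must send `a (i + s)` to the same third neighbour of `a (i + s - 1)`,
so the square fixes `s + 1` consecutive vertices. -/
theorem x_mul_self (hs : 2 ≤ s) (i : ℤ) : F.x i * F.x i = 1 := by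
  have hfix : F.x i * F.x i ∈ F.fix i (i + s - 1) :=
    mul_mem (F.x_mem_fix le_rfl (by omega)) (F.x_mem_fix le_rfl (by omega))
  refine F.eq_one_of_mem_fix (j := i + s - 1 + 1) (i := i) (by omega) (F.mem_fix_succ hfix ?_)
  have h1 := F.x_fix i (i + s - 1) (by omega) (by omega)
  have h2 := F.x_fix i (i + s - 1 - 1) (by omega) (by omega)
  have h3 : F.x i • F.a (i + s - 1 + 1) ≠ F.a (i + s - 1 + 1) := by
    rw [sub_add_cancel]; exact F.x_move_right i
  have := smul_eq_smul_of_moved hΓ hG (F.adj_left _) (F.adj _) (F.left_ne_right _)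
    h1 (inv_smul_eq_iff.2 h1.symm) h2 (inv_smul_eq_iff.2 h2.symm) h3
    (fun h ↦ h3 (inv_smul_eq_iff.1 h).symm)
  rw [mul_smul, this, smul_inv_smul]

/-- The stabilizer of `a i, …, a j` is generated by the `x k` it contains. -/
theorem fix_le {H : Subgroup G} {i j : ℤ} (hij : i < j)
    (hH : ∀ k, j - s + 1 ≤ k → k ≤ i → F.x k ∈ H) : F.fix i j ≤ H := by
  -- Induction on how many vertices the segment lacks for regularity. An element moving `a (j + 1)`
  -- agrees there with `x (j - s + 1)`; dividing by the latter lands in the stabilizer of a longer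
  -- segment.
  obtain ⟨n, hn⟩ : ∃ n : ℕ, i + s ≤ j + n := ⟨(i + s - j).toNat, by omega⟩
  induction n generalizing j with
  | zero =>
    intro h hh
    rw [F.eq_one_of_mem_fix (by omega) hh]
    exact one_mem H
  | succ n ih =>
    intro h hh
    by_cases hjs : i + s ≤ j
    · rw [F.eq_one_of_mem_fix hjs hh]
      exact one_mem H
    have ih' : F.fix i (j + 1) ≤ H :=
      ih (by omega) (fun k h1 h2 ↦ hH k (by omega) h2) (by push_cast at hn; omega)
    by_cases hm : h • F.a (j + 1) = F.a (j + 1)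
    · exact ih' (F.mem_fix_succ hh hm)
    · have hxm : F.x (j - s + 1) ∈ F.fix i j := F.x_mem_fix (by omega) (by omega)
      have hx := F.x_move_right (j - s + 1)
      rw [show j - s + 1 + s = j + 1 by ring] at hx
      have := smul_eq_smul_of_moved hΓ hG (F.adj_left j) (F.adj j) (F.left_ne_right j)
        (hh j (by omega) le_rfl) (hxm j (by omega) le_rfl) (hh (j - 1) (by omega) (by omega))
        (hxm (j - 1) (by omega) (by omega)) hm hx
      have h2 := ih' (F.mem_fix_succ (mul_mem (inv_mem hxm) hh) (by
        rw [mul_smul, this, inv_smul_smul]))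
      have h3 := mul_mem (hH (j - s + 1) le_rfl (by omega)) h2
      rwa [mul_inv_cancel_left] at h3

/-- Both elements fix `a (i + m), …, a (i + s - 1)`. One more vertex is gained at each end, because
there one of the two fixes the whole neighbourhood of the end vertex. -/
theorem commutator_mem_fix {i m : ℤ} (hm : 0 < m) (hms : m ≤ s - 2) :
    F.x i * F.x (i + m) * (F.x i)⁻¹ * (F.x (i + m))⁻¹ ∈ F.fix (i + m - 1) (i + s) := by
  set y := F.x i with hy
  set z := F.x (i + m) with hz
  have hy' : ∀ k, i ≤ k → k < i + s → y • F.a k = F.a k := F.x_fix i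
  have hz' : ∀ k, i + m ≤ k → k < i + m + s → z • F.a k = F.a k := F.x_fix (i + m)
  have hyf : ∀ k, i ≤ k → k < i + s → y⁻¹ • F.a k = F.a k := fun k h1 h2 ↦
    inv_smul_eq_iff.2 (hy' k h1 h2).symm
  have hzf : ∀ k, i + m ≤ k → k < i + m + s → z⁻¹ • F.a k = F.a k := fun k h1 h2 ↦
    inv_smul_eq_iff.2 (hz' k h1 h2).symm
  -- Fixing a vertex and two of its neighbours forces `φ` to fix the third, hence whatever neighbour
  -- `χ • d` is.
  have third : ∀ {v b d : V} {φ χ : G}, Γ.Adj v b → Γ.Adj v d → b ≠ d → φ • v = v → φ • b = b →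
      φ • d = d → χ • v = v → χ • b = b → φ • χ • d = χ • d := by
    intro v b d φ χ hb hd hbd h1 h2 h3 h4 h5
    by_cases hχ : χ • d = d
    · rw [hχ, h3]
    obtain ⟨c, -, hcb, hcd, hc⟩ := hΓ.exists_third hb hd hbd
    have aux : ∀ w, Γ.Adj v w → w ≠ b → w ≠ d → w = c := fun w h1 h2 h3 ↦ by
      rcases hc w h1 with h | h | h
      exacts [absurd h h2, absurd h h3, h]
    have e1 : χ • d = c := by
      refine aux _ (by simpa [h4] using hG χ _ _ hd) (fun h ↦ hbd ?_) hχ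
      exact smul_left_cancel χ (h5.trans h.symm)
    have hc' : Γ.Adj v c := by rw [← e1]; simpa [h4] using hG χ _ _ hd
    rw [e1]
    refine aux _ (by simpa [h1] using hG φ _ _ hc') (fun h ↦ hcb ?_) (fun h ↦ hcd ?_)
    · exact smul_left_cancel φ (h.trans h2.symm)
    · exact smul_left_cancel φ (h.trans h3.symm)
  have base : y * z * y⁻¹ * z⁻¹ ∈ F.fix (i + m) (i + s - 1) := fun k h1 h2 ↦ by
    rw [mul_smul, mul_smul, mul_smul, hzf k (by omega) (by omega), hyf k (by omega) (by omega),
      hz' k (by omega) (by omega), hy' k (by omega) (by omega)]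
  have right := F.mem_fix_succ base (by
    rw [sub_add_cancel, mul_smul, mul_smul, mul_smul, hzf (i + s) (by omega) (by omega)]
    have : z • y⁻¹ • F.a (i + s) = y⁻¹ • F.a (i + s) := by
      refine third (v := F.a (i + s - 1)) (F.adj_left _) ?_ ?_ (hz' _ (by omega) (by omega))
        (hz' _ (by omega) (by omega)) (hz' _ (by omega) (by omega)) (hyf _ (by omega) (by omega))
        (hyf _ (by omega) (by omega))
      · have := F.adj (i + s - 1)
        rwa [sub_add_cancel] at this
      · have := F.left_ne_right (i + s - 1)
        rwa [sub_add_cancel] at this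
    rw [this, smul_inv_smul])
  rw [sub_add_cancel] at right
  refine F.mem_fix_pred right ?_
  rw [mul_smul, mul_smul, mul_smul]
  have : y⁻¹ • z⁻¹ • F.a (i + m - 1) = z⁻¹ • F.a (i + m - 1) :=
    third (v := F.a (i + m)) (F.adj _) (F.adj_left _) (F.left_ne_right _).symm
      (hyf _ (by omega) (by omega)) (hyf _ (by omega) (by omega)) (hyf _ (by omega) (by omega))
      (hzf _ (by omega) (by omega)) (hzf _ (by omega) (by omega))
  rw [this, smul_inv_smul, hy' _ (by omega) (by omega)]

/-- Only the identity fixes `a (s - 1)` and `a s` and commutes with `x 0, x 1, x (s - 1), x s`. -/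
theorem eq_one_of_commute [FaithfulSMul G V] (hc : Γ.Connected) (hs : 2 ≤ s) {z : G}
    (h0 : Commute z (F.x 0)) (h1 : Commute z (F.x 1)) (h2 : Commute z (F.x (s - 1)))
    (h3 : Commute z (F.x s)) (hu : z • F.a (s - 1) = F.a (s - 1)) (hw : z • F.a s = F.a s) :
    z = 1 := by
  set M := Subgroup.centralizer {z} with hM
  have mem : ∀ {y : G}, Commute z y → y ∈ M := fun h ↦ by
    rw [hM, Subgroup.mem_centralizer_singleton_iff]; exact h.symm
  -- Around `a (i + s - 1)`, `x i` and `x (i + s - 1)` each fix one of the two walk neighbours and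
  -- swap the other two neighbours, so together they are transitive on all three.
  have nbrs : ∀ i, F.x i ∈ M → F.x (i + s - 1) ∈ M → ∀ w, Γ.Adj (F.a (i + s - 1)) w →
      ∃ m ∈ M, m • F.a (i + s) = w := by
    intro i hi hi' w hw
    have eadj := F.adj (i + s - 1)
    have ene := F.left_ne_right (i + s - 1)
    rw [sub_add_cancel] at eadj ene
    obtain ⟨c, -, hc1, hc2, hc⟩ := hΓ.exists_third (F.adj_left (i + s - 1)) eadj ene
    have f1 : F.x i • F.a (i + s - 1) = F.a (i + s - 1) := F.x_fix _ _ (by omega) (by omega)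
    have f2 : F.x i • F.a (i + s - 1 - 1) = F.a (i + s - 1 - 1) :=
      F.x_fix _ _ (by omega) (by omega)
    have e1 : F.x i • F.a (i + s) = c := by
      have := hG (F.x i) _ _ eadj
      rw [f1] at this
      rcases hc _ this with h | h | h
      · exact absurd (smul_left_cancel _ (f2.trans h.symm)) ene
      · exact absurd h (F.x_move_right i)
      · exact h
    have g1 : F.x (i + s - 1) • F.a (i + s - 1) = F.a (i + s - 1) :=
      F.x_fix _ _ (by omega) (by omega)
    have g2 : F.x (i + s - 1) • F.a (i + s) = F.a (i + s) := F.x_fix _ _ (by omega) (by omega)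
    have e2 : F.x (i + s - 1) • F.a (i + s - 1 - 1) = c := by
      have := hG (F.x (i + s - 1)) _ _ (F.adj_left (i + s - 1))
      rw [g1] at this
      rcases hc _ this with h | h | h
      · exact absurd h (F.x_move_left _)
      · exact absurd (smul_left_cancel _ (h.trans g2.symm)) ene
      · exact h
    rcases hc w hw with rfl | rfl | rfl
    · refine ⟨(F.x (i + s - 1))⁻¹ * F.x i, mul_mem (inv_mem hi') hi, ?_⟩
      rw [mul_smul, e1, ← e2, inv_smul_smul]
    · exact ⟨1, one_mem M, one_smul ..⟩
    · exact ⟨F.x i, hi, e1⟩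
  have nu : ∀ w, Γ.Adj (F.a (s - 1)) w → ∃ m ∈ M, m • F.a s = w := by
    have := nbrs 0 (mem h0) (by rw [zero_add]; exact mem h2)
    simpa using this
  have nw : ∀ w, Γ.Adj (F.a s) w → ∃ m ∈ M, m • F.a (s - 1) = w := by
    have := nbrs 1 (mem h1) (by rw [add_sub_cancel_left]; exact mem h3)
    rw [add_sub_cancel_left] at this
    obtain ⟨m₀, hm₀, e₀⟩ := this _ (F.adj_left s)
    intro w hw
    obtain ⟨m, hm, e⟩ := this w hw
    exact ⟨m * m₀⁻¹, mul_mem hm (inv_mem hm₀), by rw [mul_smul, ← e₀, inv_smul_smul, e]⟩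
  have all : ∀ w, ∃ m ∈ M, w = m • F.a s ∨ w = m • F.a (s - 1) := by
    refine forall_of_connected hc (v := F.a s) ⟨1, one_mem M, Or.inl (one_smul ..).symm⟩ ?_
    rintro u w huw ⟨m, hm, rfl | rfl⟩
    · have := hG m⁻¹ _ _ huw
      rw [inv_smul_smul] at this
      obtain ⟨m', hm', e⟩ := nw _ this
      exact ⟨m * m', mul_mem hm hm', Or.inr (by rw [mul_smul, e, smul_inv_smul])⟩
    · have := hG m⁻¹ _ _ huw
      rw [inv_smul_smul] at this
      obtain ⟨m', hm', e⟩ := nu _ this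
      exact ⟨m * m', mul_mem hm hm', Or.inl (by rw [mul_smul, e, smul_inv_smul])⟩
  refine FaithfulSMul.eq_of_smul_eq_smul (α := V) fun w ↦ ?_
  obtain ⟨m, hm, h⟩ := all w
  rw [hM, Subgroup.mem_centralizer_singleton_iff] at hm
  rw [one_smul]
  rcases h with rfl | rfl
  · rw [← mul_smul, ← hm, mul_smul, hw]
  · rw [← mul_smul, ← hm, mul_smul, hu]

include F in
/-- **Tutte's theorem**, in a weak form. -/
theorem length_le [FaithfulSMul G V] (hc : Γ.Connected) : s ≤ 7 := by
  by_contra! hs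
  have comm0 : ∀ i m, Commute (F.x 0) (F.x m) → Commute (F.x i) (F.x (i + m)) := fun i m h ↦ by
    have := F.commute_shift 0 m i h
    rwa [zero_add, add_comm] at this
  have comm' : ∀ l : ℕ, (∀ m < l, Commute (F.x 0) (F.x m)) →
      ∀ i j : ℤ, i - j < l → j - i < l → Commute (F.x i) (F.x j) := by
    intro l hmin i j h1 h2
    rcases le_total i j with h | h
    · have := comm0 i _ (hmin (j - i).toNat (by omega))
      rwa [show i + ((j - i).toNat : ℤ) = j by omega] at this
    · have := comm0 j _ (hmin (i - j).toNat (by omega))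
      rw [show j + ((i - j).toNat : ℤ) = i by omega] at this
      exact this.symm
  -- Otherwise `x (s / 2)` has index distance less than `l` from `0, 1, s - 1, s` and fixes `a (s -
  -- 1)` and `a s`, so it would be trivial.
  have bound : ∀ l : ℕ, (∀ m < l, Commute (F.x 0) (F.x m)) → 2 * (l - 1 : ℤ) < s := by
    intro l hmin
    by_contra! hcon
    have hz := comm' l hmin
    exact F.x_ne (s / 2) <| F.eq_one_of_commute hΓ hG hc (by omega) (hz _ _ (by omega) (by omega))
      (hz _ _ (by omega) (by omega)) (hz _ _ (by omega) (by omega)) (hz _ _ (by omega) (by omega))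
      (F.x_fix _ _ (by omega) (by omega)) (F.x_fix _ _ (by omega) (by omega))
  have ex : ∃ n : ℕ, ¬ Commute (F.x 0) (F.x n) := by
    by_contra! hcon
    have := bound (s.toNat + 2) fun m _ ↦ hcon m
    push_cast at this
    omega
  classical
  obtain ⟨l, hl, hmin⟩ : ∃ l : ℕ, ¬ Commute (F.x 0) (F.x l) ∧
      ∀ m < l, Commute (F.x 0) (F.x m) :=
    ⟨Nat.find ex, Nat.find_spec ex, fun m hm ↦ not_not.1 (Nat.find_min ex hm)⟩
  have hl0 : 0 < l := by
    rcases Nat.eq_zero_or_pos l with rfl | h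
    · exact absurd (Commute.refl _) hl
    · exact h
  have comm := comm' l hmin
  have ncomm : ∀ i : ℤ, ¬ Commute (F.x i) (F.x (i + l)) := fun i h ↦ hl <| by
    have := F.commute_shift _ _ (-i) h
    simpa using this
  have upper := bound l hmin
  have fix_comm : ∀ (i j k : ℤ), i < j → k - l < j - s + 1 → i < k + l → ∀ y ∈ F.fix i j,
      Commute (F.x k) y := by
    intro i j k hij h1 h2 y hy
    have := F.fix_le hΓ hG (H := Subgroup.centralizer {F.x k}) hij (fun m h3 h4 ↦ by
      rw [Subgroup.mem_centralizer_singleton_iff]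
      exact (comm _ _ (by omega) (by omega)).eq) hy
    rw [Subgroup.mem_centralizer_singleton_iff] at this
    exact this.symm
  set c := F.x 0 * F.x l * (F.x 0)⁻¹ * (F.x l)⁻¹ with hc
  have hc1 : c ≠ 1 := fun h ↦ hl <| by
    rw [hc, mul_inv_eq_one, mul_inv_eq_iff_eq_mul] at h
    exact h
  have hcfix : c ∈ F.fix (l - 1) s := by
    have := F.commutator_mem_fix hΓ hG (i := 0) (m := l) (by omega) (by omega)
    simpa only [zero_add] using this
  have exμ : ∃ n : ℕ, c ∉ F.fix (l - 1) (n + s) :=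
    ⟨l - 1, fun h ↦ hc1 (F.eq_one_of_mem_fix (by omega) h)⟩
  -- The segment fixed by `c` ends at `a (μ + s - 1)` on the right and, with `ν` below, begins at `a
  -- ν` on the left.
  obtain ⟨μ, hμ, hμ'⟩ : ∃ μ : ℕ, c ∉ F.fix (l - 1) (μ + s) ∧
      ∀ m < μ, c ∈ F.fix (l - 1) (m + s) :=
    ⟨Nat.find exμ, Nat.find_spec exμ, fun m hm ↦ not_not.1 (Nat.find_min exμ hm)⟩
  have hμ0 : 0 < μ := by
    rcases Nat.eq_zero_or_pos μ with rfl | h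
    · exact absurd (by simpa using hcfix) hμ
    · exact h
  have hμl : μ < l := by
    by_contra! h
    exact hc1 (F.eq_one_of_mem_fix (by omega) (hμ' (l - 1) (by omega)))
  have hcμ : c ∈ F.fix (l - 1) (μ + s - 1) := by
    have := hμ' (μ - 1) (by omega)
    rwa [show ((μ - 1 : ℕ) : ℤ) + s = μ + s - 1 by omega] at this
  have exν : ∃ n : ℕ, c ∉ F.fix (l - 1 - n) s :=
    ⟨l - 1, fun h ↦ hc1 (F.eq_one_of_mem_fix (by omega) h)⟩
  obtain ⟨n, hn, hn'⟩ : ∃ n : ℕ, c ∉ F.fix (l - 1 - n) s ∧ ∀ m < n, c ∈ F.fix (l - 1 - m) s :=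
    ⟨Nat.find exν, Nat.find_spec exν, fun m hm ↦ not_not.1 (Nat.find_min exν hm)⟩
  have hn0 : 0 < n := by
    rcases Nat.eq_zero_or_pos n with rfl | h
    · exact absurd (by simpa using hcfix) hn
    · exact h
  have hnl : n < l := by
    by_contra! h
    exact hc1 (F.eq_one_of_mem_fix (by omega) (hn' (l - 1) (by omega)))
  obtain ⟨ν, hν⟩ : ∃ ν : ℤ, ν = l - n := ⟨_, rfl⟩
  have hcν : c ∈ F.fix ν s := by
    have := hn' (n - 1) (by omega)
    rwa [show (l : ℤ) - 1 - ((n - 1 : ℕ) : ℤ) = ν by omega] at this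
  have hcν' : c ∉ F.fix (ν - 1) s := by
    rwa [show ν - 1 = (l : ℤ) - 1 - n by omega]
  -- Otherwise the nontrivial `c` would fix `s + 1` consecutive vertices.
  have hμν : (μ : ℤ) ≤ ν := by
    by_contra! h
    refine hc1 (F.eq_one_of_mem_fix (i := ν) (j := μ + s - 1) (by omega) fun k h1 h2 ↦ ?_)
    rcases le_or_gt k s with h3 | h3
    · exact hcν k h1 h3
    · exact hcμ k (by omega) h2
  -- Otherwise `x (l + μ)` commutes with both `c` and `(x μ)⁻¹ * c`, hence with `x μ`, although
  -- their indices differ by `l`.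
  have lower1 : s - 1 ≤ l + μ := by
    by_contra! h
    have key : (F.x μ)⁻¹ * c ∈ F.fix (l - 1) (μ + s) := by
      have hx : F.x μ ∈ F.fix (l - 1) (μ + s - 1) := F.x_mem_fix (by omega) (by omega)
      have h1 := mul_mem (inv_mem hx) hcμ
      have h2 : c • F.a (μ + s - 1 + 1) ≠ F.a (μ + s - 1 + 1) := fun e ↦ hμ <| by
        have := F.mem_fix_succ hcμ e
        rwa [sub_add_cancel] at this
      have h3 := F.x_move_right μ
      rw [← sub_add_cancel (μ + s : ℤ) 1] at h3
      have h4 := smul_eq_smul_of_moved hΓ hG (F.adj_left _) (F.adj _) (F.left_ne_right _)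
        (hcμ _ (by omega) le_rfl) (hx _ (by omega) le_rfl) (hcμ _ (by omega) (by omega))
        (hx _ (by omega) (by omega)) h2 h3
      have := F.mem_fix_succ h1 (by rw [mul_smul, h4, inv_smul_smul])
      rwa [sub_add_cancel] at this
    have h1 : Commute (F.x (l + μ)) c := by
      refine commute_commutator (F.x_mul_self hΓ hG (by omega) 0)
        (comm _ _ (by omega) (by omega)) ?_
      refine fix_comm (l + μ - 1) s _ (by omega) (by omega) (by omega) _ ?_
      have := F.commutator_mem_fix hΓ hG (i := 0) (m := l + μ) (by omega) (by omega)
      simpa only [zero_add] using this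
    have h2 := fix_comm _ _ (l + μ) (by omega) (by omega) (by omega) _ key
    have h3 := h1.mul_right h2.inv_right
    rw [mul_inv_rev, inv_inv, mul_inv_cancel_left] at h3
    exact ncomm μ (by rw [add_comm]; exact h3.symm)
  -- The mirror image, with `x (ν - l)` and `x ν`.
  have lower2 : s - 1 ≤ 2 * l - ν := by
    by_contra! h
    have key : (F.x ν)⁻¹ * c ∈ F.fix (ν - 1) s := by
      have hx : F.x ν ∈ F.fix ν s := F.x_mem_fix (by omega) (by omega)
      have h1 := mul_mem (inv_mem hx) hcν
      have h4 := smul_eq_smul_of_moved hΓ hG (F.adj _) (F.adj_left _) (F.left_ne_right _).symm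
        (hcν ν (by omega) (by omega)) (hx ν (by omega) (by omega)) (hcν _ (by omega) (by omega))
        (hx _ (by omega) (by omega)) (fun e ↦ hcν' (F.mem_fix_pred hcν e)) (F.x_move_left ν)
      exact F.mem_fix_pred h1 (by rw [mul_smul, h4, inv_smul_smul])
    have h1 : Commute (F.x (ν - l)) c⁻¹ := by
      have e : c⁻¹ = F.x l * F.x 0 * (F.x l)⁻¹ * (F.x 0)⁻¹ := by rw [hc]; group
      rw [e]
      refine commute_commutator (F.x_mul_self hΓ hG (by omega) l)
        (comm _ _ (by omega) (by omega)) ?_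
      have h2 := F.commutator_mem_fix hΓ hG (i := ν - l) (m := 2 * l - ν) (by omega) (by omega)
      rw [show ν - l + (2 * l - ν) = (l : ℤ) by ring] at h2
      have h3 := fix_comm _ _ 0 (by omega) (by omega) (by omega) _ (inv_mem h2)
      have e' : (F.x (ν - l) * F.x l * (F.x (ν - l))⁻¹ * (F.x l)⁻¹)⁻¹ =
        F.x l * F.x (ν - l) * (F.x l)⁻¹ * (F.x (ν - l))⁻¹ := by group
      rwa [e'] at h3
    have h2 := fix_comm _ _ (ν - l) (by omega) (by omega) (by omega) _ key
    have h3 := h1.inv_right.mul_right h2.inv_right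
    rw [inv_inv, mul_inv_rev, inv_inv, mul_inv_cancel_left] at h3
    exact ncomm (ν - l) (by rw [sub_add_cancel]; exact h3)
  -- Adding the lower bounds gives `2 (s - 1) ≤ 3 l`, while `upper` says `2 l ≤ s + 1`; hence `4 (s
  -- - 1) ≤ 3 (s + 1)`, so `s ≤ 7`.
  omega

end ShiftedArc
end Tutte

/-! ### Bounding vertex stabilizers -/

section Stabilizer

variable {V : Type*} {G : Type*} [Group G] [MulAction G V] {Γ : SimpleGraph V}

/-- Regularity on `(n + 2)`-arcs yields a `ShiftedArc`. -/
theorem nonempty_shiftedArc [Nonempty V] (hΓ : IsCubic Γ) (hG : PreservesAdj G Γ) {n : ℕ}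
    (hT : ArcTransitive G Γ (n + 2))
    (hreg : ∀ α, IsArc Γ (n + 2) α → ∀ φ : G, (∀ i ≤ n + 2, φ • α i = α i) → φ = 1) :
    Nonempty (ShiftedArc G Γ ((n + 2 : ℕ) : ℤ)) := by
  obtain ⟨α, hα⟩ := hΓ.exists_isArc (n + 2)
  -- `g` shifts the arc by one step, so its powers extend the arc to a bi-infinite walk and
  -- conjugate `x` along it.
  obtain ⟨g, hg⟩ := hT _ _ (hα.mono (Nat.le_succ _)) hα.tail
  have hgα : ∀ i : ℕ, i ≤ n + 3 → g ^ (i : ℤ) • α 0 = α i := by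
    intro i
    induction i with
    | zero => simp
    | succ i ih =>
      intro hi
      rw [Nat.cast_succ, add_comm, zpow_add, zpow_one, mul_smul, ih (by omega), hg i (by omega)]
  obtain ⟨a, ha⟩ : ∃ a : ℤ → V, ∀ i, a i = g ^ i • α 0 := ⟨_, fun _ ↦ rfl⟩
  have shift : ∀ i j, g ^ i • a j = a (i + j) := fun i j ↦ by
    rw [ha, ha, zpow_add, mul_smul]
  have ha' : ∀ (i : ℤ) (k : ℕ), k ≤ n + 3 → a (i + k) = g ^ i • α k := fun i k hk ↦ by
    rw [← shift, ha, hgα k hk]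
  have adj : ∀ i, Γ.Adj (a i) (a (i + 1)) := fun i ↦ by
    have h0 := ha' i 0 (by omega)
    have h1 := ha' i 1 (by omega)
    rw [Nat.cast_zero, add_zero] at h0
    rw [Nat.cast_one] at h1
    rw [h0, h1]
    exact hG _ _ _ (hα.1 0 (by omega))
  have ne : ∀ i, a i ≠ a (i + 2) := fun i ↦ by
    have h0 := ha' i 0 (by omega)
    have h1 := ha' i 2 (by omega)
    rw [Nat.cast_zero, add_zero] at h0
    rw [Nat.cast_ofNat] at h1
    rw [h0, h1]
    exact fun e ↦ hα.2 0 (by omega) (smul_left_cancel _ e)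
  have arc : ∀ i, IsArc Γ (n + 2) (fun k : ℕ ↦ a (i + k)) := fun i ↦ by
    refine ⟨fun k _ ↦ ?_, fun k _ ↦ ?_⟩
    · have := adj (i + k)
      rwa [add_assoc] at this
    · have := ne (i + k)
      rwa [add_assoc] at this
  obtain ⟨w, hw, hβ⟩ := (arc 0).exists_other hΓ
  obtain ⟨x, hx⟩ := hT _ _ (arc 0) hβ
  have hxfix : ∀ k : ℤ, 0 ≤ k → k < (n + 2 : ℕ) → x • a k = a k := by
    intro k h1 h2
    obtain ⟨k, rfl⟩ := Int.eq_ofNat_of_zero_le h1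
    have := hx k (by omega)
    rw [Function.update_of_ne (by omega), zero_add] at this
    exact this
  have hxne : x ≠ 1 := by
    rintro rfl
    have := hx (n + 2) le_rfl
    rw [Function.update_self, one_smul] at this
    exact hw this.symm
  refine ⟨⟨a, fun i ↦ g ^ i * x * (g ^ i)⁻¹, adj, ne, ?_, ?_, ?_, ?_⟩⟩
  · intro i h hh
    exact hreg _ (arc i) h fun k hk ↦ hh _ (by omega) (by omega)
  · intro i k h1 h2
    rw [mul_smul, mul_smul, ← zpow_neg, shift, hxfix _ (by omega) (by omega), shift,
      add_neg_cancel_left]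
  · intro i h
    rw [mul_inv_eq_one] at h
    exact hxne (mul_eq_left.1 h)
  · intro i j m h
    have := h.map (MulAut.conj (g ^ m))
    simp only [MulAut.conj_apply] at this
    have e : ∀ i, g ^ m * (g ^ i * x * (g ^ i)⁻¹) * (g ^ m)⁻¹ =
        g ^ (i + m) * x * (g ^ (i + m))⁻¹ := fun i ↦ by
      rw [add_comm, zpow_add, mul_inv_rev]; group
    rwa [e, e] at this

theorem IsCubic.exists_label (hΓ : IsCubic Γ) (v : V) :
    ∃ f : V → Fin 3, Set.InjOn f (Γ.neighborSet v) := by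
  have hfin : Finite (Γ.neighborSet v) := Set.finite_of_ncard_ne_zero (by rw [hΓ v]; decide)
  have e := Finite.equivFinOfCardEq (n := 3) (α := Γ.neighborSet v) (hΓ v)
  classical
  refine ⟨fun w ↦ if h : w ∈ Γ.neighborSet v then e ⟨w, h⟩ else 0, fun w hw w' hw' h ↦ ?_⟩
  simpa [hw, hw'] using h

/-- The order of a vertex stabilizer is bounded by a constant. -/
theorem exists_card_stabilizer_le [Finite V] [FaithfulSMul G V] (hc : Γ.Connected)
    (hΓ : IsCubic Γ) (hG : PreservesAdj G Γ) (h1 : ArcTransitive G Γ 1) :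
    ∃ v : V, Nat.card (MulAction.stabilizer G v) ≤ 3 ^ 7 := by
  have := hc.nonempty
  obtain ⟨n, hT, hn⟩ := exists_maximal_arcTransitive (G := G) hΓ h1
  have hreg : ∀ α, IsArc Γ (n + 1) α → ∀ φ : G, (∀ i ≤ n + 1, φ • α i = α i) → φ = 1 :=
    fun α hα φ ↦ eq_one_of_maximal hc hΓ hG hT hn hα
  have hn7 : n + 1 ≤ 7 := by
    rcases n with _ | n
    · omega
    · obtain ⟨F⟩ := nonempty_shiftedArc hΓ hG hT hreg
      exact_mod_cast F.length_le hΓ hG hc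
  obtain ⟨α, hα⟩ := hΓ.exists_isArc n
  choose f hf using hΓ.exists_label
  refine ⟨α 0, ?_⟩
  -- By regularity an element is determined by the image of `α`. From the fixed start, each step of
  -- the image is one of three labels, giving `3 ^ (n + 1)` possibilities.
  have hinj : Function.Injective (fun (φ : MulAction.stabilizer G (α 0)) (i : Fin (n + 1)) ↦
      f ((φ : G) • α i) ((φ : G) • α (i + 1))) := by
    rintro ⟨φ, hφ⟩ ⟨ψ, hψ⟩ h
    have key : ∀ i, i ≤ n + 1 → φ • α i = ψ • α i := by
      intro i
      induction i with
      | zero => exact fun _ ↦ hφ.trans hψ.symm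
      | succ i ih =>
        intro hi
        have e := congrFun h ⟨i, by omega⟩
        have ei := ih (by omega)
        simp only [ei] at e
        refine hf _ ?_ ?_ e
        · rw [← ei]; exact hG _ _ _ (hα.1 i (by omega))
        · exact hG _ _ _ (hα.1 i (by omega))
    have := hreg α hα (ψ⁻¹ * φ) fun i hi ↦ by rw [mul_smul, key i hi, inv_smul_smul]
    exact Subtype.ext (inv_mul_eq_one.1 this).symm
  have := Nat.card_le_card_of_injective _ hinj
  rw [Nat.card_fun, Nat.card_fin, Nat.card_fin] at this
  exact this.trans (Nat.pow_le_pow_right (by omega) hn7)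

end Stabilizer

/-! ### Finite groups: normal Sylow subgroups and complements -/

section Groups

variable {G : Type*} [Group G]

theorem card_sylow_eq_of_card_eq_mul [Finite G] {p m : ℕ} [hp : Fact p.Prime] (hm : ¬ p ∣ m)
    (hG : Nat.card G = p * m) (P : Sylow p G) : Nat.card P = p := by
  have hm0 : m ≠ 0 := fun h ↦ hm (h ▸ dvd_zero p)
  rw [P.card_eq_multiplicity, hG, Nat.factorization_mul hp.out.ne_zero hm0, Finsupp.add_apply,
    hp.out.factorization_self, Nat.factorization_eq_zero_of_not_dvd hm, add_zero, pow_one]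

/-- The number of Sylow `p`-subgroups is `1` modulo `p` and at most `m < p`. -/
theorem exists_normal_of_card_eq_mul [Finite G] {p m : ℕ} (hp : p.Prime) (hm : m < p)
    (hG : Nat.card G = p * m) : ∃ P : Subgroup G, P.Normal ∧ Nat.card P = p := by
  have := Fact.mk hp
  have hm0 : 0 < m := by
    have : 0 < p * m := by rw [← hG]; exact Nat.card_pos
    exact Nat.pos_of_ne_zero fun h ↦ by simp [h] at this
  obtain ⟨P⟩ : Nonempty (Sylow p G) := inferInstance
  have hP := card_sylow_eq_of_card_eq_mul (Nat.not_dvd_of_pos_of_lt hm0 hm) hG P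
  have hi : (P : Subgroup G).index = m := by
    have := (P : Subgroup G).card_mul_index
    rw [hG] at this
    exact Nat.eq_of_mul_eq_mul_left hp.pos (by rw [← this]; congr 1; exact hP.symm)
  have h1 := Nat.le_of_dvd (by rwa [hi]) P.card_dvd_index
  rw [hi] at h1
  have h2 := card_sylow_modEq_one p G
  have h3 : Nat.card (Sylow p G) = 1 := by
    rw [Nat.ModEq, Nat.mod_eq_of_lt (h1.trans_lt hm), Nat.mod_eq_of_lt hp.one_lt] at h2
    exact h2
  have := (Nat.card_eq_one_iff_unique.1 h3).1
  exact ⟨P, P.normal_of_subsingleton, hP⟩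

/-- A normal subgroup `P` of prime order which is a Sylow subgroup has, inside its centralizer,
a complement which is normal in the whole group and contains all `p'`-elements. -/
theorem exists_normal_complement_centralizer [Finite G] {p m : ℕ} (hp : p.Prime) (hm : ¬ p ∣ m)
    (hG : Nat.card G = p * m) {P : Subgroup G} (hPn : P.Normal) (hP : Nat.card P = p) :
    ∃ K : Subgroup G, K.Normal ∧ K ≤ Subgroup.centralizer P ∧
      ∀ x ∈ Subgroup.centralizer (P : Set G), x ∈ K ↔ ¬ p ∣ orderOf x := by
  have := Fact.mk hp
  set C := Subgroup.centralizer (P : Set G) with hC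
  have hPcyc : IsCyclic P := isCyclic_of_prime_card hP
  have hPC : P ≤ C := fun x hx y hy ↦ by
    have := hPcyc.isMulCommutative.is_comm.comm ⟨y, hy⟩ ⟨x, hx⟩
    exact congrArg Subtype.val this
  obtain ⟨t, ht⟩ := exists_prime_orderOf_dvd_card' (G := P) p (by rw [hP])
  have htc : (⟨t, hPC t.2⟩ : C) ∈ Subgroup.center C := by
    rw [Subgroup.mem_center_iff]
    rintro ⟨g, hg⟩
    exact Subtype.ext (hg t t.2).symm
  have hpc : p ∣ Nat.card (Subgroup.center C) := by
    have := orderOf_dvd_natCard (⟨⟨t, hPC t.2⟩, htc⟩ : Subgroup.center C)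
    rwa [Subgroup.orderOf_mk, Subgroup.orderOf_mk, Subgroup.orderOf_coe, ht] at this
  obtain ⟨c, hc⟩ := hpc
  set N := (Subgroup.center C).index * c with hN
  have hcard : Nat.card C = p * N := by
    rw [← (Subgroup.center C).card_mul_index, hc, hN]; ring
  have hpN : ¬ p ∣ N := fun h ↦ hm <| by
    have h1 := C.card_subgroup_dvd_card
    rw [hcard, hG] at h1
    exact h.trans (Nat.dvd_of_mul_dvd_mul_left hp.pos h1)
  -- Transfer to the center is the power map with exponent the index of the center. Its `c`-th power
  -- is `x ↦ x ^ N`, where `|C| = p * N`, so the kernel consists of the elements of order prime to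
  -- `p`.
  let F : C →* Subgroup.center C :=
    { toFun x := MonoidHom.transferCenterPow C x ^ c
      map_one' := by rw [map_one, one_pow]
      map_mul' x y := by
        have : Commute (MonoidHom.transferCenterPow C x) (MonoidHom.transferCenterPow C y) :=
          Subtype.ext (Subgroup.mem_center_iff.1 (MonoidHom.transferCenterPow C y).2 _)
        rw [map_mul, this.mul_pow] }
  have hF : ∀ x : C, ((F x : C) : G) = (x : G) ^ N := fun x ↦ by
    simp [F, hN, pow_mul]
  refine ⟨F.ker.map C.subtype, ⟨?_⟩, ?_, ?_⟩
  · rintro _ ⟨x, hx, rfl⟩ g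
    have hCn : C.Normal := inferInstance
    refine ⟨⟨g * x * g⁻¹, hCn.conj_mem _ x.2 g⟩, ?_, rfl⟩
    have h1 := hF x
    rw [MonoidHom.mem_ker.1 hx] at h1
    apply Subtype.ext
    apply Subtype.ext
    rw [hF, conj_pow, ← h1]
    simp
  · rintro _ ⟨x, hx, rfl⟩
    exact x.2
  · intro x hx
    have e : x ∈ F.ker.map C.subtype ↔ x ^ N = 1 := by
      constructor
      · rintro ⟨y, hy, rfl⟩
        have h1 := hF y
        rw [MonoidHom.mem_ker.1 hy] at h1
        exact h1.symm
      · intro h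
        exact ⟨⟨x, hx⟩, Subtype.ext (Subtype.ext ((hF ⟨x, hx⟩).trans h)), rfl⟩
    rw [e, ← orderOf_dvd_iff_pow_eq_one]
    refine ⟨fun h h' ↦ hpN (h'.trans h), fun h ↦ ?_⟩
    have h1 := orderOf_dvd_natCard (⟨x, hx⟩ : C)
    rw [Subgroup.orderOf_mk, hcard] at h1
    exact ((hp.coprime_iff_not_dvd.2 h).symm).dvd_of_dvd_mul_left h1

/-- Commutators centralize every normal subgroup of prime order. -/
theorem commutator_mem_centralizer {P : Subgroup G} (hPn : P.Normal)
    (hP : (Nat.card P).Prime) (x y : G) :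
    x * y * x⁻¹ * y⁻¹ ∈ Subgroup.centralizer (P : Set G) := by
  have := Fact.mk hP
  have hPcyc : IsCyclic P := isCyclic_of_prime_card rfl
  have hcomm : ∀ a b : MulAut P, a * b = b * a := fun a b ↦
    (IsCyclic.mulAutMulEquiv P).injective (by rw [map_mul, map_mul, mul_comm])
  have h : MulAut.conjNormal (H := P) (x * y * x⁻¹ * y⁻¹) = 1 := by
    rw [map_mul, map_mul, map_mul, hcomm (MulAut.conjNormal x), map_inv, map_inv]
    group
  intro t ht
  have h2 := congrArg Subtype.val (DFunLike.congr_fun h ⟨t, ht⟩)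
  rw [MulAut.conjNormal_apply, MulAut.one_apply, mul_inv_eq_iff_eq_mul] at h2
  exact h2.symm

/-- A group of order `6 l`, with `l` a prime congruent to `5` modulo `6`, is not generated by
an element of order dividing `3` and an element of order dividing `2`. -/
theorem closure_pair_ne_top {l : ℕ} (hl : l.Prime) (hl5 : l % 6 = 5) (hG : Nat.card G = 6 * l)
    {h g : G} (hh : h ^ 3 = 1) (hg : g ^ 2 = 1) : Subgroup.closure {h, g} ≠ ⊤ := by
  intro htop
  have hfin : Finite G := Nat.finite_of_card_ne_zero (by have := hl.pos; omega)
  have f2 := Fact.mk Nat.prime_two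
  have f3 := Fact.mk Nat.prime_three
  have hl' : 5 ≤ l := by omega
  obtain ⟨Q⟩ : Nonempty (Sylow 2 G) := inferInstance
  have hQ := card_sylow_eq_of_card_eq_mul (m := 3 * l) (by omega) (by omega) Q
  have hmin : (Nat.card G).minFac = 2 := by
    rw [hG, Nat.minFac_eq_two_iff]
    exact ⟨3 * l, by ring⟩
  have hcompl := IsCyclic.isComplement' hmin (isCyclic_of_prime_card hQ)
  set N := (MonoidHom.transferSylow Q
    ((isCyclic_of_prime_card hQ).normalizer_le_centralizer hmin)).ker with hN
  have hindex : N.index = 2 := by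
    rw [hcompl.symm.index_eq_card]; exact hQ
  have hNcard : Nat.card N = 3 * l := by
    have := N.card_mul_index
    rw [hindex, hG] at this
    omega
  have hNn : N.Normal := inferInstance
  obtain ⟨S⟩ : Nonempty (Sylow 3 N) := inferInstance
  have hS := card_sylow_eq_of_card_eq_mul (by omega) hNcard S
  have hSi : (S : Subgroup N).index = l := by
    have := (S : Subgroup N).card_mul_index
    rw [hNcard] at this
    exact Nat.eq_of_mul_eq_mul_left (by omega : 0 < 3) (by rw [← this]; congr 1; exact hS.symm)
  -- The count divides `l` and is `1` modulo `3`, whereas `l` is `2` modulo `3`.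
  have hS1 : Nat.card (Sylow 3 N) = 1 := by
    have h1 := S.card_dvd_index
    rw [hSi] at h1
    have h2 : Nat.card (Sylow 3 N) % 3 = 1 := card_sylow_modEq_one 3 N
    rcases (Nat.dvd_prime hl).1 h1 with h | h <;> omega
  have := (Nat.card_eq_one_iff_unique.1 hS1).1
  have memS : ∀ x : G, x ∈ (S : Subgroup N).map N.subtype ↔ x ^ 3 = 1 := by
    intro x
    constructor
    · rintro ⟨y, hy, rfl⟩
      have h1 := pow_card_eq_one' (x := (⟨y, hy⟩ : (S : Subgroup N)))
      rw [hS] at h1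
      exact congrArg (fun z : (S : Subgroup N) ↦ ((z : N) : G)) h1
    · intro hx
      -- Here `x = x ^ 4` is a square, and squares lie in a subgroup of index `2`.
      have hxN : x ∈ N := by
        have h1 := Subgroup.sq_mem_of_index_two hindex (x ^ 2)
        rwa [← pow_mul, show 2 * 2 = 3 + 1 by rfl, pow_succ, hx, one_mul] at h1
      have hpg : IsPGroup 3 (Subgroup.zpowers (⟨x, hxN⟩ : N)) := by
        rintro ⟨y, k, rfl⟩
        refine ⟨1, Subtype.ext ?_⟩
        have : (⟨x, hxN⟩ : N) ^ 3 = 1 := Subtype.ext hx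
        simp only [pow_one, Subgroup.coe_pow, Subgroup.coe_one]
        rw [← zpow_natCast, ← zpow_mul, mul_comm, zpow_mul, zpow_natCast, this, one_zpow]
      obtain ⟨T, hT⟩ := hpg.exists_le_sylow
      rw [Subsingleton.elim T S] at hT
      exact ⟨_, hT (Subgroup.mem_zpowers _), rfl⟩
  set R := (S : Subgroup N).map N.subtype with hR
  have hRn : R.Normal := ⟨fun x hx y ↦ by
    rw [memS] at hx ⊢
    rw [conj_pow, hx, mul_one, mul_inv_cancel]⟩
  have hRcard : Nat.card R = 3 := by
    rw [hR, Subgroup.card_map_of_injective N.subtype_injective]; exact hS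
  have hquot : Nat.card (G ⧸ R) ≤ 2 := by
    have hsurj : ∀ q : G ⧸ R, q ∈ Subgroup.zpowers (g : G ⧸ R) := by
      intro q
      obtain ⟨y, rfl⟩ := QuotientGroup.mk_surjective q
      have hy : y ∈ (Subgroup.zpowers (g : G ⧸ R)).comap (QuotientGroup.mk' R) := by
        have : Subgroup.closure {h, g} ≤
            (Subgroup.zpowers (g : G ⧸ R)).comap (QuotientGroup.mk' R) := by
          rw [Subgroup.closure_le]
          rintro z (rfl | rfl)
          · have : (z : G ⧸ R) = 1 := (QuotientGroup.eq_one_iff z).2 ((memS z).2 hh)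
            change (z : G ⧸ R) ∈ Subgroup.zpowers (g : G ⧸ R)
            rw [this]
            exact one_mem _
          · exact Subgroup.mem_zpowers _
        exact this (by rw [htop]; trivial)
      exact hy
    rw [← orderOf_eq_card_of_forall_mem_zpowers hsurj]
    refine orderOf_le_of_pow_eq_one (by omega) ?_
    rw [← QuotientGroup.mk_pow, hg]
    rfl
  have h6 := R.card_eq_card_quotient_mul_card_subgroup
  rw [hG, hRcard] at h6
  omega

end Groups

/-! ### Excluding large primes -/

section Main

variable {V : Type*} {G : Type*} [Group G] [MulAction G V] {Γ : SimpleGraph V}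

/-- `G` has a single orbit on ordered pairs of adjacent vertices. -/
def TransitiveOnArcs (G : Type*) [Group G] [MulAction G V] (Γ : SimpleGraph V) : Prop :=
  ∀ u v u' v' : V, Γ.Adj u v → Γ.Adj u' v' → ∃ g : G, g • u = u' ∧ g • v = v'

theorem TransitiveOnArcs.arcTransitive (h : TransitiveOnArcs G Γ) : ArcTransitive G Γ 1 := by
  intro α β hα hβ
  obtain ⟨g, h0, h1⟩ := h _ _ _ _ (hα.1 0 (by omega)) (hβ.1 0 (by omega))
  refine ⟨g, fun i hi ↦ ?_⟩
  interval_cases i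
  exacts [h0, h1]

/-- A normal subgroup of an arc-transitive group on a cubic graph either has vertex stabilizers
acting trivially on neighbourhoods or has at most two orbits. -/
theorem fixes_neighbors_or_two_orbits (hc : Γ.Connected) (hΓ : IsCubic Γ)
    (hG : PreservesAdj G Γ) (harc : TransitiveOnArcs G Γ) {K : Subgroup G} (hK : K.Normal) :
    (∀ k ∈ K, ∀ v, k • v = v → ∀ w, Γ.Adj v w → k • w = w) ∨
      ∃ v w : V, ∀ u, (∃ k ∈ K, u = k • v) ∨ ∃ k ∈ K, u = k • w := by
  rw [or_iff_not_imp_left]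
  intro hcon
  push Not at hcon
  obtain ⟨k, hk, v, hkv, w, hvw, hkw⟩ := hcon
  have hvkw : Γ.Adj v (k • w) := by simpa [hkv] using hG k _ _ hvw
  obtain ⟨c, hvc, hcw, hckw, hnb⟩ := hΓ.exists_third hvw hvkw hkw.symm
  -- A conjugate of `k` fixes `v` and moves `c`, joining it to `w` or `k • w` inside one `K`-orbit.
  have hcw' : ∃ k' ∈ K, k' • w = c := by
    obtain ⟨h, hhv, hhw⟩ := harc _ _ _ _ hvw hvc
    set k' := h * k * h⁻¹ with hk'
    have hk'K : k' ∈ K := hK.conj_mem k hk h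
    have hh : h⁻¹ • c = w := by rw [← hhw, inv_smul_smul]
    have e : k' • c = h • k • w := by rw [hk', mul_smul, mul_smul, hh]
    have hadj : Γ.Adj v (k' • c) := by
      rw [e]; simpa [hhv] using hG h _ _ hvkw
    rcases hnb _ hadj with h1 | h1 | h1
    · exact ⟨k'⁻¹, inv_mem hk'K, by rw [← h1, inv_smul_smul]⟩
    · exact ⟨k'⁻¹ * k, mul_mem (inv_mem hk'K) hk, by rw [mul_smul, ← h1, inv_smul_smul]⟩
    · rw [e, ← hhw] at h1
      exact absurd (smul_left_cancel h h1) hkw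
  have base : ∀ w', Γ.Adj v w' → ∃ k' ∈ K, k' • w = w' := by
    intro w' hw'
    rcases hnb w' hw' with rfl | rfl | rfl
    exacts [⟨1, one_mem K, one_smul ..⟩, ⟨k, hk, rfl⟩, hcw']
  have all : ∀ u a b, Γ.Adj u a → Γ.Adj u b → ∃ k' ∈ K, k' • a = b := by
    intro u a b ha hb
    obtain ⟨g, rfl, rfl⟩ := harc _ _ _ _ hvw ha
    have := hG g⁻¹ _ _ hb
    rw [inv_smul_smul] at this
    obtain ⟨k', hk', e⟩ := base _ this
    exact ⟨g * k' * g⁻¹, hK.conj_mem k' hk' g, by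
      rw [mul_smul, mul_smul, inv_smul_smul, e, smul_inv_smul]⟩
  refine ⟨v, w, forall_of_connected hc (v := v) (Or.inl ⟨1, one_mem K, (one_smul ..).symm⟩) ?_⟩
  rintro u u' huu' (⟨k', hk', rfl⟩ | ⟨k', hk', rfl⟩)
  · have := hG k'⁻¹ _ _ huu'
    rw [inv_smul_smul] at this
    obtain ⟨k'', hk'', e⟩ := all v _ _ hvw this
    exact Or.inr ⟨k' * k'', mul_mem hk' hk'', by rw [mul_smul, e, smul_inv_smul]⟩
  · have := hG k'⁻¹ _ _ huu'
    rw [inv_smul_smul] at this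
    obtain ⟨k'', hk'', e⟩ := all w _ _ hvw.symm this
    exact Or.inl ⟨k' * k'', mul_mem hk' hk'', by rw [mul_smul, e, smul_inv_smul]⟩

theorem card_stabilizer_eq_three (hΓ : IsCubic Γ) (hG : PreservesAdj G Γ)
    (harc : TransitiveOnArcs G Γ)
    (hfree : ∀ (g : G) (v w : V), Γ.Adj v w → g • v = v → g • w = w → g = 1) (v : V) :
    Nat.card (MulAction.stabilizer G v) = 3 := by
  obtain ⟨w, hw, -⟩ := hΓ.exists_adj_ne v v
  have hadj : ∀ x : MulAction.stabilizer G v, Γ.Adj v ((x : G) • w) := fun x ↦ by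
    simpa [MulAction.mem_stabilizer_iff.1 x.2] using hG x _ _ hw
  rw [← hΓ v, Set.ncard]
  refine Nat.card_congr (Equiv.ofBijective
    (fun x : MulAction.stabilizer G v ↦ (⟨(x : G) • w, hadj x⟩ : Γ.neighborSet v)) ⟨?_, ?_⟩)
  · rintro ⟨x, hx⟩ ⟨y, hy⟩ h
    have h1 : x • w = y • w := congrArg Subtype.val h
    have := hfree (y⁻¹ * x) v w hw
      (by rw [mul_smul, MulAction.mem_stabilizer_iff.1 hx, inv_smul_eq_iff,
        MulAction.mem_stabilizer_iff.1 hy])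
      (by rw [mul_smul, h1, inv_smul_smul])
    exact Subtype.ext (inv_mul_eq_one.1 this).symm
  · rintro ⟨w', hw'⟩
    obtain ⟨g, h1, h2⟩ := harc _ _ _ _ hw hw'
    exact ⟨⟨g, h1⟩, Subtype.ext h2⟩

/-- A vertex stabilizer and an element reversing an edge at the vertex generate. -/
theorem closure_stabilizer_union_eq_top (hc : Γ.Connected) (hG : PreservesAdj G Γ)
    (harc : TransitiveOnArcs G Γ) {v w : V} (hvw : Γ.Adj v w) {g : G} (hg : g • v = w) :
    Subgroup.closure ((MulAction.stabilizer G v : Set G) ∪ {g}) = ⊤ := by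
  set M := Subgroup.closure ((MulAction.stabilizer G v : Set G) ∪ {g})
  have hgM : g ∈ M := Subgroup.subset_closure (Or.inr rfl)
  have hsM : ∀ x : G, x • v = v → x ∈ M := fun x hx ↦ Subgroup.subset_closure (Or.inl hx)
  have all : ∀ u, ∃ m ∈ M, m • v = u := by
    refine forall_of_connected hc (v := v) ⟨1, one_mem M, one_smul ..⟩ ?_
    rintro _ u' huu' ⟨m, hm, rfl⟩
    have := hG m⁻¹ _ _ huu'
    rw [inv_smul_smul] at this
    obtain ⟨h, h1, h2⟩ := harc _ _ _ _ hvw this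
    exact ⟨m * (h * g), mul_mem hm (mul_mem (hsM h h1) hgM), by
      rw [mul_smul, mul_smul, hg, h2, smul_inv_smul]⟩
  rw [eq_top_iff]
  intro x _
  obtain ⟨m, hm, e⟩ := all (x • v)
  have := mul_mem hm (hsM (m⁻¹ * x) (by rw [mul_smul, ← e, inv_smul_smul]))
  rwa [mul_inv_cancel_left] at this

variable [FaithfulSMul G V]

theorem eq_one_of_forall_fixes_neighbors (hc : Γ.Connected) {k : G}
    (h : ∀ v, k • v = v → ∀ w, Γ.Adj v w → k • w = w) {v : V} (hv : k • v = v) : k = 1 :=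
  FaithfulSMul.eq_of_smul_eq_smul (α := V) fun u ↦ by
    rw [one_smul]
    exact forall_of_connected hc (Q := fun u ↦ k • u = u) hv (fun u w huw hu ↦ h u hu w huw) u

/-- If an arc-transitive group on a cubic graph has a normal Sylow subgroup of odd prime order `p`
and `p`-regular vertex stabilizers, then arc stabilizers are trivial. -/
theorem eq_one_of_fixes_arc [Finite G] (hc : Γ.Connected) (hΓ : IsCubic Γ)
    (hG : PreservesAdj G Γ) (harc : TransitiveOnArcs G Γ) {p m : ℕ} (hp : p.Prime) (hp2 : 2 < p)
    (hm : ¬ p ∣ m) (hcard : Nat.card G = p * m) {P : Subgroup G} (hPn : P.Normal)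
    (hP : Nat.card P = p) (hord : ∀ (g : G) (v : V), g • v = v → ¬ p ∣ orderOf g)
    {g : G} {v w : V} (hvw : Γ.Adj v w) (hv : g • v = v) (hw : g • w = w) : g = 1 := by
  obtain ⟨K, hK, hKC, hKp⟩ := exists_normal_complement_centralizer hp hm hcard hPn hP
  have hPord : ∀ z ∈ P, z ≠ 1 → orderOf z = p := by
    intro z hz hz1
    have h1 := orderOf_dvd_natCard (⟨z, hz⟩ : P)
    rw [Subgroup.orderOf_mk, hP] at h1
    exact ((Nat.dvd_prime hp).1 h1).resolve_left (mt orderOf_eq_one_iff.1 hz1)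
  have hPC : P ≤ Subgroup.centralizer (P : Set G) := by
    have := Fact.mk hp
    have hPcyc : IsCyclic P := isCyclic_of_prime_card hP
    intro x hx y hy
    exact congrArg Subtype.val (hPcyc.isMulCommutative.is_comm.comm ⟨y, hy⟩ ⟨x, hx⟩)
  -- If `z • u = k • u`, then `k⁻¹ * z` fixes `u`, so it has order prime to `p` and lies in `K`;
  -- this would put `z`, of order `p`, in `K`.
  have move : ∀ z ∈ P, z ≠ 1 → ∀ u : V, ∀ k ∈ K, z • u ≠ k • u := by
    intro z hz hz1 u k hk e
    have h1 : (k⁻¹ * z) • u = u := by rw [mul_smul, e, inv_smul_smul]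
    have h2 := (hKp _ (mul_mem (inv_mem (hKC hk)) (hPC hz))).2 (hord _ u h1)
    have h3 := mul_mem hk h2
    rw [mul_inv_cancel_left] at h3
    exact (hKp z (hPC hz)).1 h3 (hPord z hz hz1).symm.dvd
  -- With only two `K`-orbits, `z` would swap them and `z * z ≠ 1` would preserve them; this is
  -- where `p > 2` enters.
  have hKfix : ∀ k ∈ K, ∀ v, k • v = v → ∀ w, Γ.Adj v w → k • w = w := by
    refine (fixes_neighbors_or_two_orbits hc hΓ hG harc hK).resolve_right ?_
    rintro ⟨v, w, hvw⟩
    obtain ⟨⟨z, hz⟩, hz1⟩ : ∃ z : P, z ≠ 1 := by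
      have : 1 < Nat.card P := by rw [hP]; exact hp.one_lt
      have := Finite.one_lt_card_iff_nontrivial.1 this
      exact exists_ne 1
    have hz1' : z ≠ 1 := fun h ↦ hz1 (Subtype.ext h)
    have hzz : z * z ≠ 1 := fun h ↦ by
      have := orderOf_dvd_of_pow_eq_one ((pow_two z).trans h)
      rw [hPord z hz hz1'] at this
      exact absurd (Nat.le_of_dvd (by omega) this) (by omega)
    rcases hvw (z • v) with ⟨k, hk, e⟩ | ⟨k, hk, e⟩
    · exact move z hz hz1' v k hk e
    rcases hvw (z • w) with ⟨k', hk', e'⟩ | ⟨k', hk', e'⟩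
    · refine move (z * z) (mul_mem hz hz) hzz v (k * k') (mul_mem hk hk') ?_
      have hzk : z * k = k * z := hKC hk z hz
      rw [mul_smul, e, ← mul_smul, hzk, mul_smul, e', ← mul_smul]
    · exact move z hz hz1' w k' hk' e'
  have hC : ∀ x ∈ Subgroup.centralizer (P : Set G), ∀ v : V, x • v = v → x = 1 := by
    intro x hx v hv
    have hxK := (hKp x hx).2 (hord x v hv)
    exact eq_one_of_forall_fixes_neighbors hc (hKfix x hxK) hv
  have hcomm : ∀ (v : V) (x y : G), x • v = v → y • v = v → x * y = y * x := by
    intro v x y hx hy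
    have := hC _ (commutator_mem_centralizer hPn (by rwa [hP]) x y) v (by
      rw [mul_smul, mul_smul, mul_smul, inv_smul_eq_iff.2 hy.symm, inv_smul_eq_iff.2 hx.symm,
        hy, hx])
    rwa [mul_inv_eq_one, mul_inv_eq_iff_eq_mul] at this
  -- The stabilizer of `v` is abelian and transitive on the neighbours, so an element fixing one
  -- neighbour fixes all.
  have nbrs : ∀ v w, Γ.Adj v w → g • v = v → g • w = w → ∀ w', Γ.Adj v w' → g • w' = w' := by
    intro v w hvw hv hw w' hvw'
    obtain ⟨h, hhv, rfl⟩ := harc _ _ _ _ hvw hvw'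
    rw [← mul_smul, hcomm v g h hv hhv, mul_smul, hw]
  have all : ∀ u, g • u = u ∧ ∀ u', Γ.Adj u u' → g • u' = u' := by
    refine forall_of_connected hc (v := v) ⟨hv, nbrs v w hvw hv hw⟩ ?_
    rintro a b hab ⟨ha, h⟩
    exact ⟨h b hab, nbrs b a hab.symm (h b hab) ha⟩
  exact FaithfulSMul.eq_of_smul_eq_smul (α := V) fun u ↦ by rw [one_smul, (all u).1]

/-- The order bound: large primes do not occur. -/
theorem prime_le_of_card_eq [Finite V] [Finite G] (hc : Γ.Connected) (hΓ : IsCubic Γ)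
    (hG : PreservesAdj G Γ) (harc : TransitiveOnArcs G Γ) {l p : ℕ} (hl : l.Prime)
    (hl5 : l % 6 = 5) (hp : p.Prime) (hV : Nat.card V = 2 * l * p) : p ≤ 2 * l * 3 ^ 7 := by
  by_contra! hlt
  obtain ⟨v₀, hv₀⟩ := exists_card_stabilizer_le hc hΓ hG harc.arcTransitive
  have htrans : MulAction.IsPretransitive G V := ⟨fun u v ↦ by
    obtain ⟨a, ha, -⟩ := hΓ.exists_adj_ne u u
    obtain ⟨b, hb, -⟩ := hΓ.exists_adj_ne v v
    obtain ⟨g, hg, -⟩ := harc _ _ _ _ ha hb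
    exact ⟨g, hg⟩⟩
  have hstab : ∀ v : V, Nat.card (MulAction.stabilizer G v) * (2 * l * p) = Nat.card G := fun v ↦ by
    rw [← hV, ← MulAction.index_stabilizer_of_transitive G v, Subgroup.card_mul_index]
  have hlp : 0 < 2 * l * p := Nat.mul_pos (Nat.mul_pos two_pos hl.pos) hp.pos
  have hstab' : ∀ v : V, Nat.card (MulAction.stabilizer G v) ≤ 3 ^ 7 := fun v ↦ by
    rwa [Nat.eq_of_mul_eq_mul_right hlp ((hstab v).trans (hstab v₀).symm)]
  set m := 2 * l * Nat.card (MulAction.stabilizer G v₀) with hm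
  have hcard : Nat.card G = p * m := by rw [← hstab v₀, hm]; ring
  have hmp : m < p := (Nat.mul_le_mul_left _ hv₀).trans_lt hlt
  have hm0 : 0 < m := Nat.mul_pos (Nat.mul_pos two_pos hl.pos) Nat.card_pos
  have hp7 : 3 ^ 7 < p := lt_of_le_of_lt (Nat.le_mul_of_pos_left _ (by have := hl.pos; omega)) hlt
  obtain ⟨P, hPn, hP⟩ := exists_normal_of_card_eq_mul hp hmp hcard
  have hord : ∀ (g : G) (v : V), g • v = v → ¬ p ∣ orderOf g := by
    intro g v hg hdvd
    have h1 := orderOf_dvd_natCard (⟨g, MulAction.mem_stabilizer_iff.2 hg⟩ : MulAction.stabilizer G v)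
    rw [Subgroup.orderOf_mk] at h1
    have h2 := Nat.le_of_dvd Nat.card_pos (hdvd.trans h1)
    have := hstab' v
    omega
  have hfree : ∀ (g : G) (v w : V), Γ.Adj v w → g • v = v → g • w = w → g = 1 :=
    fun g v w h h1 h2 ↦ eq_one_of_fixes_arc hc hΓ hG harc hp (by omega)
      (Nat.not_dvd_of_pos_of_lt hm0 hmp) hcard hPn hP hord h h1 h2
  have h3 := card_stabilizer_eq_three hΓ hG harc hfree
  obtain ⟨w, hvw, -⟩ := hΓ.exists_adj_ne v₀ v₀
  obtain ⟨g, hgv, hgw⟩ := harc _ _ _ _ hvw hvw.symm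
  have hg2 : g ^ 2 = 1 := hfree _ v₀ w hvw (by rw [pow_two, mul_smul, hgv, hgw])
    (by rw [pow_two, mul_smul, hgw, hgv])
  have f3 := Fact.mk Nat.prime_three
  obtain ⟨h, hh⟩ := (isCyclic_of_prime_card (h3 v₀)).exists_generator
  have hh3 : (h : G) ^ 3 = 1 := by
    have := pow_card_eq_one' (x := h)
    rw [h3] at this
    exact congrArg Subtype.val this
  have hgen : Subgroup.closure {(h : G), g} = ⊤ := by
    rw [eq_top_iff, ← closure_stabilizer_union_eq_top hc hG harc hvw hgv, Subgroup.closure_le]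
    rintro x (hx | rfl)
    · obtain ⟨k, hk⟩ := hh ⟨x, hx⟩
      have : x = (h : G) ^ k := congrArg Subtype.val hk.symm
      rw [this]
      exact Subgroup.zpow_mem _ (Subgroup.subset_closure (Set.mem_insert _ _)) k
    · exact Subgroup.subset_closure (Or.inr rfl)
  have hquot : Nat.card (G ⧸ P) = 6 * l := by
    have h6 := P.card_eq_card_quotient_mul_card_subgroup
    rw [hP, ← hstab v₀, h3] at h6
    refine Nat.eq_of_mul_eq_mul_right hp.pos (h6.symm.trans ?_)
    ring
  refine closure_pair_ne_top hl hl5 hquot (h := ((h : G) : G ⧸ P)) (g := (g : G ⧸ P)) ?_ ?_ ?_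
  · rw [← QuotientGroup.mk_pow, hh3]; rfl
  · rw [← QuotientGroup.mk_pow, hg2]; rfl
  · have := congrArg (Subgroup.map (QuotientGroup.mk' P)) hgen
    rw [MonoidHom.map_closure, Set.image_pair,
      Subgroup.map_top_of_surjective _ (QuotientGroup.mk'_surjective P)] at this
    exact this

end Main

/-! ### From the bound on the prime to finiteness -/

theorem finitelyManyOfOrderMulPrime_two_mul {l : ℕ} (hl : l.Prime) (hl5 : l % 6 = 5) :
    FinitelyManyOfOrderMulPrime.{u} (2 * l) := by
  set N := 2 * l * (2 * l * 3 ^ 7)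
  refine ⟨Set.range (fun x : Σ n : Fin (N + 1), SimpleGraph (Fin n) ↦ ⟨x.1, x.2⟩),
    Set.finite_range _, ?_⟩
  intro V Γ h
  have := h.finite
  obtain ⟨p, hp, hV⟩ := h.order
  have hfin : Finite (Γ ≃g Γ) := DFunLike.finite _
  have hle : p ≤ 2 * l * 3 ^ 7 := prime_le_of_card_eq (G := Γ ≃g Γ) h.connected h.cubic
    (fun φ _ _ huv ↦ φ.map_adj_iff.2 huv) h.symmetric hl hl5 hp hV
  have hcard : Nat.card V ≤ N := by rw [hV]; exact Nat.mul_le_mul_left _ hle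
  have := Fintype.ofFinite V
  exact ⟨_, ⟨⟨⟨Nat.card V, by omega⟩, Γ.overFin Nat.card_eq_fintype_card.symm⟩, rfl⟩,
    ⟨Γ.overFinIso Nat.card_eq_fintype_card.symm⟩⟩

end CubicSymmetric

theorem theorem6p1 :
    {k : ℕ | 0 < k ∧ Even k ∧ CubicSymmetric.FinitelyManyOfOrderMulPrime.{u} k}.Infinite ∧
    ∀ l : ℕ, l.Prime → l % 6 = 5 →
      CubicSymmetric.FinitelyManyOfOrderMulPrime.{u} (2 * l) := by
  have main : ∀ l : ℕ, l.Prime → l % 6 = 5 →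
      CubicSymmetric.FinitelyManyOfOrderMulPrime.{u} (2 * l) :=
    fun _ ↦ CubicSymmetric.finitelyManyOfOrderMulPrime_two_mul
  refine ⟨Set.infinite_of_forall_exists_gt fun n ↦ ?_, main⟩
  obtain ⟨l, hn, hl, hl5⟩ := Nat.forall_exists_prime_gt_and_modEq n (q := 6) (a := 5)
    (by norm_num) (by norm_num)
  exact ⟨2 * l, ⟨by have := hl.pos; omega, even_two_mul l, main l hl hl5⟩, by omega⟩
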